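/- Let $\mathbf{C}$ be a quasitopos, i.e., a category that has all finite limits and finite colimits, is locally cartesian closed, and has a regular-subobject classifier. A *PBPO rule* $\rho$ consists of a top span $L \xleftarrow{l} K \xrightarrow{r} R$, a bottom span $L' \xleftarrow{l'} K' \xrightarrow{r'} R'$, and morphisms $t_L : L \to L'$, $t_K : K \to K'$, $t_R : R \to R'$ with $t_L l = l' t_K$ and $t_R r = r' t_K$. A *PBPO step* from $G_L$ to $G_R$ with match $m : L \to G_L$ and adherence $\alpha : G_L \to L'$ exists if $t_L = \alpha m$ and there are a pullback $G_L \xleftarrow{g_L} G_K \xrightarrow{u'} K'$ of $G_L \xrightarrow{\alpha} L' \xleftarrow{l'} K'$, the unique $u : K \to G_K$ with $g_L u = m l$ and $u' u = t_K$, a pushout $G_K \xrightarrow{g_R} G_R \xleftarrow{w} R$ of $G_K \xleftarrow{u} K \xrightarrow{r} R$, and the unique $w' : G_R \to R'$ with $w' g_R = r' u'$ and $w' w = t_R$. Write $G_L \Rightarrow^{\rho}_{\mathrm{PBPO}} G_R$ if such a step exists for some $m$ and $\alpha$, and $G_L \Rightarrow^{\rho}_{\mathrm{PBPO}^{\hookrightarrow}}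 G_R$ if such a step exists for some $m$ and $\alpha$ with $m$ a regular monomorphism. A *PBPO$^{+}$ rule* $\tau$ consists of a span $L \xleftarrow{l} K \xrightarrow{r} R$ and morphisms $t_L : L \to L'$, $t_K : K \to K'$, $l' : K' \to L'$ such that $L \xleftarrow{l} K \xrightarrow{t_K} K'$ is a pullback of $L \xrightarrow{t_L} L' \xleftarrow{l'} K'$. Write $G_L \Rightarrow^{\tau}_{\mathrm{PBPO}^{+}} G_R$ if there are $m : L \to G_L$ and $\alpha : G_L \to L'$ such that $G_L \xleftarrow{m} L \xrightarrow{1_L} L$ is a pullback of $G_L \xrightarrow{\alpha} L' \xleftarrow{t_L} L$, together with a pullback $G_L \xleftarrow{g_L} G_K \xrightarrow{u'} K'$ of $G_L \xrightarrow{\alpha} L' \xleftarrow{l'} K'$, the (necessarily unique) $u : K \to G_K$ with $u' u = t_K$, and a pushout $G_K \xrightarrow{g_R} G_R \xleftarrow{w} R$ of $G_K \xleftarrow{u} K \xrightarrow{r} R$. Then for every PBPO rule $\rho$ in $\mathbf{C}$: 1. There exists a single PBPO$^{+}$ rule $\tau$ in $\mathbf{C}$ such that ${\Rightarrow^{\rho}_{\mathrm{PBPO}^{\hookrightarrow}}}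 = {\Rightarrow^{\tau}_{\mathrm{PBPO}^{+}}}$ as relations on the objects of $\mathbf{C}$. 2. If $t_L$ of $\rho$ is a regular monomorphism, then there exists a single PBPO$^{+}$ rule $\tau$ in $\mathbf{C}$ such that ${\Rightarrow^{\rho}_{\mathrm{PBPO}}} = {\Rightarrow^{\tau}_{\mathrm{PBPO}^{+}}}$ as relations on the objects of $\mathbf{C}$. -/

import Mathlib

open CategoryTheory CategoryTheory.Limits

universe v u

/-- A quasitopos: a category with all finite limits and finite colimits that is locally cartesian
closed (every base change functor between slice categories has a right adjoint) and has a
classifier of regular subobjects. -/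
class Quasitopos (C : Type u) [Category.{v} C] : Prop where
  [hasFiniteLimits : HasFiniteLimits C]
  [hasFiniteColimits : HasFiniteColimits C]
  /-- Local cartesian closure. -/
  pullback_isLeftAdjoint : ∀ {X Y : C} (f : X ⟶ Y), (Over.pullback f).IsLeftAdjoint
  /-- There is a morphism `true : 1 ⟶ Ω` such that every regular mono `m : X ⟶ A` is the pullback
  of `true` along exactly one morphism `χ : A ⟶ Ω`. -/
  exists_regularSubobjectClassifier : ∃ (Ω : C) (tr : ⊤_ C ⟶ Ω),
    ∀ {X A : C} (m : X ⟶ A), IsRegularMono m →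
      ∃! χ : A ⟶ Ω, IsPullback m (terminal.from X) χ tr

attribute [instance] Quasitopos.hasFiniteLimits Quasitopos.hasFiniteColimits

/-- A PBPO rule: a commutative diagram
```
L  <--l--  K  --r-->  R
|tL        |tK        |tR
L' <--l'-- K' --r'--> R'
```
-/
structure PBPORule (C : Type u) [Category.{v} C] where
  {L K R L' K' R' : C}
  l : K ⟶ L
  r : K ⟶ R
  l' : K' ⟶ L'
  r' : K' ⟶ R'
  tL : L ⟶ L'
  tK : K ⟶ K'
  tR : R ⟶ R'
  comm_left : l ≫ tL = tK ≫ l'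
  comm_right : r ≫ tR = tK ≫ r'

/-- A PBPO⁺ rule: a diagram
```
L  <--l--  K  --r-->  R
|tL   PB   |tK
L' <--l'-- K'
```
whose square is a pullback. -/
structure PBPOPlusRule (C : Type u) [Category.{v} C] where
  {L K R L' K' : C}
  l : K ⟶ L
  r : K ⟶ R
  l' : K' ⟶ L'
  tL : L ⟶ L'
  tK : K ⟶ K'
  isPullback : IsPullback l tK tL l'

namespace PBPORule

variable {C : Type u} [Category.{v} C]

/-- `ρ.Step m α` : the PBPO rule `ρ` induces a PBPO step from `G` to `H` with match morphism `m`
and adherence morphism `α`. -/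
def Step (ρ : PBPORule C) {G : C} (H : C) (m : ρ.L ⟶ G) (α : G ⟶ ρ.L') : Prop :=
  m ≫ α = ρ.tL ∧
  ∃ (D : C) (gL : D ⟶ G) (u' : D ⟶ ρ.K') (u : ρ.K ⟶ D)
    (gR : D ⟶ H) (w : ρ.R ⟶ H) (w' : H ⟶ ρ.R'),
    IsPullback gL u' α ρ.l' ∧
    u ≫ gL = ρ.l ≫ m ∧ u ≫ u' = ρ.tK ∧
    IsPushout u ρ.r gR w ∧
    gR ≫ w' = u' ≫ ρ.r' ∧ w ≫ w' = ρ.tR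

/-- The PBPO step relation of `ρ` on the objects of `C`. -/
def StepRel (ρ : PBPORule C) (G H : C) : Prop :=
  ∃ (m : ρ.L ⟶ G) (α : G ⟶ ρ.L'), ρ.Step H m α

/-- The PBPO step relation of `ρ` where only regular monic matches `m` are allowed. -/
def RegularMonicStepRel (ρ : PBPORule C) (G H : C) : Prop :=
  ∃ (m : ρ.L ⟶ G) (α : G ⟶ ρ.L'), ρ.Step H m α ∧ IsRegularMono m

end PBPORule

namespace PBPOPlusRule

variable {C : Type u} [Category.{v} C]

/-- `τ.Step m α` : the PBPO⁺ rule `τ` induces a PBPO⁺ step from `G` to `H` with match morphism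
`m` and adherence morphism `α`. The first conjunct says that `m` and `α` form a strong match. -/
def Step (τ : PBPOPlusRule C) {G : C} (H : C) (m : τ.L ⟶ G) (α : G ⟶ τ.L') : Prop :=
  IsPullback m (𝟙 τ.L) α τ.tL ∧
  ∃ (D : C) (gL : D ⟶ G) (u' : D ⟶ τ.K') (u : τ.K ⟶ D)
    (gR : D ⟶ H) (w : τ.R ⟶ H),
    IsPullback gL u' α τ.l' ∧
    u ≫ u' = τ.tK ∧
    IsPushout u τ.r gR w

/-- The PBPO⁺ step relation of `τ` on the objects of `C`. -/
def StepRel (τ : PBPOPlusRule C) (G H : C) : Prop :=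
  ∃ (m : τ.L ⟶ G) (α : G ⟶ τ.L'), τ.Step H m α

end PBPOPlusRule

namespace CategoryTheory

section RegularMono

variable {C : Type u} [Category.{v} C]

/-! In the slice over `L'`, partial maps with regular domain into `tL` are classified by a regular
mono `η : L ⟶ Q` with `π : Q ⟶ L'`. A regular monic match `m` is the domain of such a partial map,
so an adherence `α` lifts to some `β : G ⟶ Q` making the match strong. Replacing `L'` by `Q` and
pulling `l'` back along `π` leaves `G_K` unchanged. The interface grows from `K` to a pullback `K₁`;
pushing `r` out along `c : K ⟶ K₁` compensates, since pushout squares paste and cancel. If `tL` is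
regular monic, `isRegularMono_of_comp` makes every match regular monic. -/

lemma isRegularMono_of_exists_lift {X Y Z : C} {f : X ⟶ Y} [Mono f] (a b : Y ⟶ Z)
    (w : f ≫ a = f ≫ b)
    (h : ∀ {T : C} (k : T ⟶ Y), k ≫ a = k ≫ b → ∃ x : T ⟶ X, x ≫ f = k) :
    IsRegularMono f := by
  choose lift hlift using @h
  exact ⟨⟨{
    Z := Z
    left := a
    right := b
    w := w
    isLimit := Fork.IsLimit.mk _ (fun s => lift s.ι s.condition)
      (fun s => hlift s.ι s.condition)
      (fun s x hx => by
        rw [← cancel_mono f, hlift s.ι s.condition]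
        exact hx) }⟩⟩

lemma IsRegularMono.of_isPullback {P X Y Z : C} {fst : P ⟶ X} {snd : P ⟶ Y} {f : X ⟶ Z}
    {g : Y ⟶ Z} (h : IsPullback fst snd f g) (hg : IsRegularMono g) : IsRegularMono fst := by
  have : Mono fst := ⟨fun a b hab => h.hom_ext hab (by
    rw [← cancel_mono g, Category.assoc, Category.assoc, ← h.w, reassoc_of% hab])⟩
  refine isRegularMono_of_exists_lift (f ≫ IsRegularMono.left g) (f ≫ IsRegularMono.right g)
    (by rw [h.w_assoc, h.w_assoc, IsRegularMono.w]) fun k hk => ?_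
  exact ⟨h.lift k (IsRegularMono.lift g (k ≫ f) (by simpa using hk))
    (IsRegularMono.fac g _ _).symm, h.lift_fst _ _ _⟩

lemma isRegularMono_of_retraction {X Y : C} (s : X ⟶ Y) (r : Y ⟶ X) (h : s ≫ r = 𝟙 X) :
    IsRegularMono s := by
  have : Mono s := (SplitMono.mk r h).mono
  exact isRegularMono_of_exists_lift (r ≫ s) (𝟙 Y) (by simp [reassoc_of% h])
    fun k hk => ⟨k ≫ r, by simpa using hk⟩

instance Over.map_faithful {X Y : C} (f : X ⟶ Y) : (Over.map f).Faithful where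
  map_injective h := by
    ext
    simpa using congrArg (fun k => k.left) h

instance Over.map_full_of_mono {X Y : C} (f : X ⟶ Y) [Mono f] : (Over.map f).Full where
  map_surjective {U V} g := ⟨Over.homMk g.left (by
    rw [← cancel_mono f]
    simpa using Over.w g), by ext; rfl⟩

/-- For monic `f`, `Over.map f` is fully faithful, so its unit with pullback is invertible; in an
adjoint triple this transfers to the outer counit. -/
lemma isIso_counit_of_pullback_adjunction [HasPullbacks C] {X Y : C} (f : X ⟶ Y) [Mono f]
    {R : Over X ⥤ Over Y} (adj : Over.pullback f ⊣ R) : IsIso adj.counit := by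
  have : IsIso (Over.mapPullbackAdj f).unit := inferInstance
  exact (Adjunction.Triple.mk (Over.mapPullbackAdj f) adj).isIso_unit_iff_isIso_counit.mp this

end RegularMono

end CategoryTheory

namespace Quasitopos

variable {C : Type u} [Category.{v} C] [Quasitopos C]

/-- The classifier of partial maps with regular domain in a slice of a quasitopos. -/
theorem exists_partialMapClassifier {Y B : C} (t : Y ⟶ B) :
    ∃ (Q : C) (η : Y ⟶ Q) (π : Q ⟶ B), η ≫ π = t ∧ IsRegularMono η ∧
      ∀ {P G : C} (p : P ⟶ G) (α : G ⟶ B) (f : P ⟶ Y), IsRegularMono p → p ≫ α = f ≫ t →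
        ∃ β : G ⟶ Q, IsPullback p f β η ∧ β ≫ π = α := by
  obtain ⟨Ω, tr, hΩ⟩ := exists_regularSubobjectClassifier (C := C)
  -- `j` marks where the truth value is `true`. Pushing `t` forward along `j` keeps it intact there,
  -- as the counit is invertible.
  let j : B ⟶ Ω ⨯ B := prod.lift (terminal.from B ≫ tr) (𝟙 B)
  have hj : j ≫ prod.snd = 𝟙 B := prod.lift_snd _ _
  have : Mono j := (SplitMono.mk _ hj).mono
  have := pullback_isLeftAdjoint j
  let R := (Over.pullback j).rightAdjoint
  let adj : Over.pullback j ⊣ R := Adjunction.ofIsLeftAdjoint _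
  have := isIso_counit_of_pullback_adjunction j adj
  let X := R.obj (Over.mk t)
  let ε : (Over.pullback j).obj X ≅ Over.mk t := asIso (adj.counit.app (Over.mk t))
  let η : Y ⟶ X.left := ε.inv.left ≫ pullback.fst X.hom j
  have hη : IsPullback η t X.hom j := by
    refine (IsPullback.of_hasPullback X.hom j).of_iso ((Over.forget _).mapIso ε) (Iso.refl _)
      (Iso.refl _) (Iso.refl _) ?_ ?_ (by simp) (by simp)
    · change pullback.fst X.hom j ≫ 𝟙 _ = ε.hom.left ≫ ε.inv.left ≫ _
      rw [← Over.comp_left_assoc, ε.hom_inv_id]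
      simp
    · simpa using (Over.w ε.hom).symm
  refine ⟨X.left, η, X.hom ≫ prod.snd, by rw [hη.w_assoc, hj, Category.comp_id],
    .of_isPullback hη (isRegularMono_of_retraction j _ hj), fun {P G} p α f hp hpα => ?_⟩
  obtain ⟨χ, hχ, -⟩ := hΩ p hp
  -- Pulling `j` back along `k` recovers `P`, so `f` becomes a slice map whose adjoint transpose is
  -- `β`.
  let k : G ⟶ Ω ⨯ B := prod.lift χ α
  have hk : IsPullback p (f ≫ t) k j := by
    refine ⟨⟨?_⟩, ⟨PullbackCone.IsLimit.mk _
      (fun s => hχ.lift s.fst (terminal.from _) ?_) (fun s => hχ.lift_fst _ _ _) ?_ ?_⟩⟩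
    · ext
      · simp only [k, j, Category.assoc, prod.lift_fst, hχ.w]
        simp only [← Category.assoc]
        congr 1
        exact Subsingleton.elim _ _
      · simpa only [k, j, Category.assoc, prod.lift_snd, Category.comp_id] using hpα
    · have := s.condition =≫ prod.fst
      simp only [k, j, Category.assoc, prod.lift_fst] at this
      rw [this, ← Category.assoc]
      congr 1
      exact Subsingleton.elim _ _
    · intro s
      have := s.condition =≫ prod.snd
      simp only [k, j, Category.assoc, prod.lift_snd, Category.comp_id] at this
      exact (congrArg _ hpα.symm).trans ((hχ.lift_fst_assoc _ _ _ _).trans this)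
    · intro s x h₁ _
      exact hχ.hom_ext (by rw [h₁, hχ.lift_fst]) (Subsingleton.elim _ _)
  let e : P ≅ pullback k j := hk.isoPullback
  let φ : (Over.pullback j).obj (Over.mk k) ⟶ Over.mk t := Over.homMk (e.inv ≫ f) (by
    simp [e])
  let β : Over.mk k ⟶ X := adj.homEquiv _ _ φ
  have hβ : (Over.pullback j).map β ≫ ε.hom = φ := by
    have := (adj.homEquiv_counit (g := β)).symm
    simpa [β, ε] using this
  have hw : p ≫ β.left = f ≫ η := by
    have h₁ : ((Over.pullback j).map β).left = φ.left ≫ ε.inv.left := by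
      rw [← Over.comp_left, ← hβ, Category.assoc, ε.hom_inv_id, Category.comp_id]
    have h₂ : ((Over.pullback j).map β).left ≫ pullback.fst X.hom j
        = pullback.fst k j ≫ β.left := pullback.lift_fst _ _ _
    rw [h₁] at h₂
    have h₃ : φ.left = e.inv ≫ f := rfl
    rw [h₃, Category.assoc, Category.assoc, e.inv_comp_eq] at h₂
    rw [h₂, ← Category.assoc]
    congr 1
    exact hk.isoPullback_hom_fst.symm
  have hβk : β.left ≫ X.hom = k := Over.w β
  refine ⟨β.left, IsPullback.of_bot (by rwa [hβk]) hw hη, ?_⟩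
  rw [reassoc_of% hβk]
  exact prod.lift_snd _ _

/-- A morphism that becomes a regular mono after postcomposition is a regular mono. -/
theorem isRegularMono_of_comp {X Y Z : C} (m : X ⟶ Y) (α : Y ⟶ Z)
    (h : IsRegularMono (m ≫ α)) : IsRegularMono m := by
  have : Mono m := mono_of_mono m α
  let P := pullback α (m ≫ α)
  let p : P ⟶ Y := pullback.fst _ _
  let a : P ⟶ X := pullback.snd _ _
  have hp : IsRegularMono p := .of_isPullback (IsPullback.of_hasPullback _ _) h
  let s : X ⟶ P := pullback.lift m (𝟙 X) (by simp)
  have hsp : s ≫ p = m := pullback.lift_fst _ _ _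
  have hsa : s ≫ a = 𝟙 X := pullback.lift_snd _ _ _
  -- `m` is a split mono `s` followed by a regular mono `p`. Extending `a ≫ s` and `𝟙 P` along `p`
  -- to maps into `Q` exhibits `m` as an equalizer, once paired with the maps that `p` equalizes.
  obtain ⟨Q, η, π, -, hη, hQ⟩ := exists_partialMapClassifier (terminal.from P)
  obtain ⟨b, hb, -⟩ := hQ p (terminal.from Y) (a ≫ s) hp (Subsingleton.elim _ _)
  obtain ⟨c, hc, -⟩ := hQ p (terminal.from Y) (𝟙 P) hp (Subsingleton.elim _ _)
  refine isRegularMono_of_exists_lift (prod.lift b (IsRegularMono.left p))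
    (prod.lift c (IsRegularMono.right p)) ?_ fun k hk => ?_
  · ext
    · simp only [Category.assoc, prod.lift_fst]
      rw [← hsp, Category.assoc, Category.assoc, hb.w, hc.w]
      simp [reassoc_of% hsa]
    · simp only [Category.assoc, prod.lift_snd]
      rw [← hsp, Category.assoc, Category.assoc, IsRegularMono.w]
  · have h₁ := hk =≫ prod.fst
    have h₂ := hk =≫ prod.snd
    simp only [Category.assoc, prod.lift_fst, prod.lift_snd] at h₁ h₂
    obtain ⟨x, rfl⟩ : ∃ x, x ≫ p = k := ⟨IsRegularMono.lift p k h₂, IsRegularMono.fac p k h₂⟩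
    rw [Category.assoc, Category.assoc, hb.w, hc.w] at h₁
    have h₃ : x ≫ a ≫ s = x := by
      rw [← cancel_mono η]
      simpa using h₁
    exact ⟨x ≫ a, by rw [← hsp, Category.assoc, reassoc_of% h₃]⟩

end Quasitopos

namespace PBPORule

variable {C : Type u} [Category.{v} C] (ρ : PBPORule C)

/-- Factor `tL` as `η ≫ π`, pull the bottom left leg back along `π`, and push `r` out along the
comparison `c`. The resulting PBPO⁺ rule simulates the PBPO steps whose match is a regular mono,
provided every such match is a pullback of `η` along a lift of its adherence. -/
theorem regularMonicStepRel_eq_stepRel {Q K₁ K₂ R₁ : C} {η : ρ.L ⟶ Q} {π : Q ⟶ ρ.L'}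
    (h : η ≫ π = ρ.tL) (hη : IsRegularMono η)
    (hQ : ∀ {G : C} (m : ρ.L ⟶ G) (α : G ⟶ ρ.L'), IsRegularMono m → m ≫ α = ρ.tL →
      ∃ β : G ⟶ Q, IsPullback m (𝟙 ρ.L) β η ∧ β ≫ π = α)
    {l₂ : K₂ ⟶ Q} {q : K₂ ⟶ ρ.K'} (hK₂ : IsPullback l₂ q π ρ.l')
    {l₁ : K₁ ⟶ ρ.L} {t₁ : K₁ ⟶ K₂} (hK₁ : IsPullback l₁ t₁ η l₂)
    {c : ρ.K ⟶ K₁} (hcl : c ≫ l₁ = ρ.l) (hct : c ≫ t₁ ≫ q = ρ.tK)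
    {r₁ : K₁ ⟶ R₁} {i : ρ.R ⟶ R₁} (hR : IsPushout c ρ.r r₁ i) :
    ρ.RegularMonicStepRel = (PBPOPlusRule.mk l₁ r₁ l₂ η t₁ hK₁).StepRel := by
  ext G H
  dsimp only [RegularMonicStepRel, Step, PBPOPlusRule.StepRel, PBPOPlusRule.Step]
  constructor
  · rintro ⟨m, α, ⟨hmα, D, gL, u', u, gR, w, w', hD, hugL, huu', hH, -, -⟩, hm⟩
    obtain ⟨β, hβ, rfl⟩ := hQ m α hm hmα
    let v' : D ⟶ K₂ := hK₂.lift (gL ≫ β) u' (by rw [Category.assoc, hD.w])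
    have hv'q : v' ≫ q = u' := hK₂.lift_snd _ _ _
    have hD' : IsPullback gL v' β l₂ :=
      (IsPullback.of_bot (h₃₁ := ρ.l') (v₂₁ := q) (v₂₂ := π) (by rwa [hv'q])
        (hK₂.lift_fst _ _ _).symm hK₂)
    let v : K₁ ⟶ D := hD'.lift (l₁ ≫ m) t₁ (by
      rw [Category.assoc, hβ.w, Category.id_comp, hK₁.w])
    have hcv : c ≫ v = u := hD.hom_ext
      (by rw [Category.assoc, hD'.lift_fst, hugL, reassoc_of% hcl])
      (by rw [Category.assoc, ← hv'q, hD'.lift_snd_assoc, hct, hv'q, huu'])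
    subst hcv
    have hw : ρ.r ≫ w = c ≫ v ≫ gR := by simpa using hH.w.symm
    exact ⟨m, β, hβ, D, gL, v', v, gR, hR.desc (v ≫ gR) w hw.symm, hD', hD'.lift_snd _ _ _,
      -- Cancelling the pushout of `c` and `r` from that of `c ≫ v` and `r` leaves the pushout of
      -- `v` and `r₁`.
      IsPushout.of_left (h₁₁ := c) (v₁₁ := ρ.r) (h₂₁ := i)
        (by rwa [hR.inr_desc]) (hR.inl_desc _ _ _).symm hR⟩
  · rintro ⟨m, β, hβ, D, gL, v', v, gR, w, hD', hvv', hH⟩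
    have hD : IsPullback gL (v' ≫ q) (β ≫ π) ρ.l' := hD'.paste_vert hK₂
    have hH' : IsPushout (c ≫ v) ρ.r gR (i ≫ w) := hR.paste_horiz hH
    have hvg : v ≫ gL = l₁ ≫ m := by
      -- A PBPO⁺ step does not demand this compatibility; the strong match forces it.
      have hv : (v ≫ gL) ≫ β = l₁ ≫ η := by
        rw [Category.assoc, hD'.w, reassoc_of% hvv', hK₁.w]
      rw [← hβ.lift_fst _ _ hv]
      congr 1
      exact (Category.comp_id _).symm.trans (hβ.lift_snd _ _ hv)
    have hu' : (c ≫ v) ≫ v' ≫ q = ρ.tK := by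
      rw [Category.assoc, reassoc_of% hvv', hct]
    refine ⟨m, β ≫ π, ⟨by rw [hβ.w_assoc, Category.id_comp, h], D, gL, v' ≫ q, c ≫ v, gR, i ≫ w,
      hH'.desc ((v' ≫ q) ≫ ρ.r') ρ.tR ?_, hD, ?_, hu', hH', hH'.inl_desc _ _ _,
      hH'.inr_desc _ _ _⟩, .of_isPullback hβ hη⟩
    · rw [ρ.comm_right, ← hu']
      simp only [Category.assoc]
    · rw [Category.assoc, hvg, reassoc_of% hcl]

end PBPORule

theorem mainTheorem4 {C : Type u} [Category.{v} C] [Quasitopos C] (ρ : PBPORule C) :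
    (∃ τ : PBPOPlusRule C, ρ.RegularMonicStepRel = τ.StepRel) ∧
    (IsRegularMono ρ.tL → ∃ τ : PBPOPlusRule C, ρ.StepRel = τ.StepRel) := by
  obtain ⟨Q, η, π, h, hη, hQ⟩ := Quasitopos.exists_partialMapClassifier ρ.tL
  have hK₂ := IsPullback.of_hasPullback π ρ.l'
  have hK₁ := IsPullback.of_hasPullback η (pullback.fst π ρ.l')
  have hw : (ρ.l ≫ η) ≫ π = ρ.tK ≫ ρ.l' := by rw [Category.assoc, h, ρ.comm_left]
  have hw' : ρ.l ≫ η = hK₂.lift (ρ.l ≫ η) ρ.tK hw ≫ pullback.fst π ρ.l' :=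
    (hK₂.lift_fst _ _ _).symm
  have key := ρ.regularMonicStepRel_eq_stepRel h hη
    (fun m α hm hmα => hQ m α (𝟙 ρ.L) hm (by rw [hmα, Category.id_comp])) hK₂ hK₁
    (hK₁.lift_fst _ _ hw') (by rw [hK₁.lift_snd_assoc, hK₂.lift_snd])
    (IsPushout.of_hasPushout _ _)
  refine ⟨⟨_, key⟩, fun htL => ⟨_, Eq.trans ?_ key⟩⟩
  ext G H
  constructor
  · rintro ⟨m, α, hs⟩
    exact ⟨m, α, hs, Quasitopos.isRegularMono_of_comp m α (by rwa [hs.1])⟩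
  · rintro ⟨m, α, hs, -⟩
    exact ⟨m, α, hs⟩
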